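/- Let $A=\mathrm{diag}(a_1,\dots,a_m)$ with all $a_j>0$, let $\mathcal V$ be a linear subspace of $\mathbb R^m$ with the scalar product $(x,y)_A=\langle x,Ay\rangle$ and the norm $\|x\|^A=\sqrt{\langle x,Ax\rangle}$, and let $c:[0,\infty)\to\mathcal V$ be Lipschitz continuous. Given real numbers $c_j^{-},c_j^{+}$ ($1\le j\le m$), put $$C=\bigcap_{j=1}^m\{y\in\mathcal V: c_j^-\le\langle e_j,Ay\rangle\le c_j^+\},\qquad C(t)=C+c(t).$$ For $D\subset\mathcal V$ and $y\in D$ let $N_D^A(y)=\{x\in\mathcal V:\langle x,A(\xi-y)\rangle\le 0\ \text{for all }\xi\in D\}$, and $N_D^A(y)=\emptyset$ for $y\notin D$. A solution on $[s,\infty)$ of the sweeping process $-\dot y\in N^A_{C(t)}(y)$ is a locally absolutely continuous function $y$ with $y(t)\in C(t)$ for all $t\ge s$ that satisfies the inclusion for almost all $t\ge s$. Let $I_0\subset\{-1,+1\}\times\{1,\dots,m\}$ be such that $\{y\in\mathcal V:\langle e_j,Ay\rangle=c_j^{\alpha}\text{ for all }(\alpha,j)\in I_0\}$ is a singleton $\{y_{*,0}\}$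 (where $c_j^{\pm1}=c_j^{\pm}$), and let $y_{*,0}\in C$. Assume that for some $\varepsilon>0$ $$-\dot c(t)+B_\varepsilon^A(0)\subset N_C^A(y_{*,0})\quad\text{for almost all }t\in[0,\tau_d],\qquad \tau_d=\frac1\varepsilon\max_{v\in C}\|v-y_{*,0}\|^A,$$ where $B_\varepsilon^A(0)=\{z\in\mathcal V:\|z\|^A<\varepsilon\}$. Then every solution $y$ on $[0,\infty)$ with $y(0)\in C(0)$ satisfies $y(\tau_d)=y_{*,0}+c(\tau_d)$. Furthermore, there is exactly one solution $y_*$ on $[\tau_d,\infty)$ with $y_*(\tau_d)=y_{*,0}+c(\tau_d)$, and, if $c$ is $T$-periodic with $T>0$ and $T\ge\tau_d$, then $y_*$ is a globally one-period stable $T$-periodic solution, that is: $y_*(t+T)=y_*(t)$ for all $t\ge\tau_d$; $y_*$ is Lyapunov stable; and for every integer $k\ge0$, every solution $y$ on $[kT,\infty)$ satisfies $y(t)=y_*(t)$ for all $t\ge (k+1)T$. -/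

import Mathlib

open MeasureTheory Set

noncomputable section

namespace Sweeping

/-- Euclidean space `ℝ^m`. -/
abbrev E (m : ℕ) : Type := EuclideanSpace ℝ (Fin m)

variable {m : ℕ}

/-- The scalar product `(x, y)_A = ⟨x, A y⟩` for the diagonal matrix `A = diag(a₁, …, a_m)`. -/
def scalarA (a : Fin m → ℝ) (x y : E m) : ℝ := ∑ j, x j * (a j * y j)

/-- The norm `‖x‖^A = √⟨x, A x⟩`. -/
def normA (a : Fin m → ℝ) (x : E m) : ℝ := Real.sqrt (scalarA a x x)

/-- The half-space `L(α, j) = {y ∈ V : ⟨α e_j, A y⟩ ≤ α c_j^α}`, for a sign `α ∈ {-1, +1} = ℤˣ`.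
The numbers `c_j^-` and `c_j^+` are `b (-1) j` and `b 1 j`. -/
def halfSpace (a : Fin m → ℝ) (V : Submodule ℝ (E m)) (b : ℤˣ → Fin m → ℝ)
    (α : ℤˣ) (j : Fin m) : Set (E m) :=
  {y | y ∈ V ∧
    scalarA a (((α : ℤ) : ℝ) • EuclideanSpace.single j (1 : ℝ)) y ≤ ((α : ℤ) : ℝ) * b α j}

/-- The hyperplane `{y ∈ V : ⟨e_j, A y⟩ = c_j^α}`. -/
def hyperplane (a : Fin m → ℝ) (V : Submodule ℝ (E m)) (b : ℤˣ → Fin m → ℝ)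
    (α : ℤˣ) (j : Fin m) : Set (E m) :=
  {y | y ∈ V ∧ scalarA a (EuclideanSpace.single j (1 : ℝ)) y = b α j}

/-- The polyhedron `C = ⋂_j L(-1, j) ∩ L(+1, j)`, a subset of `V`. -/
def polyhedron (a : Fin m → ℝ) (V : Submodule ℝ (E m)) (b : ℤˣ → Fin m → ℝ) : Set (E m) :=
  {y | y ∈ V ∧ ∀ j, y ∈ halfSpace a V b (-1) j ∩ halfSpace a V b 1 j}

/-- The intersection over `(α, j) ∈ I₀` of the hyperplanes `{y ∈ V : ⟨e_j, A y⟩ = c_j^α}`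
(the whole of `V` when `I₀` is empty). -/
def face (a : Fin m → ℝ) (V : Submodule ℝ (E m)) (b : ℤˣ → Fin m → ℝ)
    (I₀ : Finset (ℤˣ × Fin m)) : Set (E m) :=
  {y | y ∈ V ∧ ∀ p ∈ I₀, y ∈ hyperplane a V b p.1 p.2}

/-- The normal cone `N_C^A(y)` in `V` (empty when `y ∉ C`). -/
def normalCone (a : Fin m → ℝ) (V : Submodule ℝ (E m)) (C : Set (E m)) (y : E m) : Set (E m) :=
  {x | y ∈ C ∧ x ∈ V ∧ ∀ ξ ∈ C, scalarA a x (ξ - y) ≤ 0}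

/-- The open ball `B_ε^A(0)` of the space `V` in the norm `‖·‖^A`. -/
def ballA (a : Fin m → ℝ) (V : Submodule ℝ (E m)) (ε : ℝ) : Set (E m) :=
  {z | z ∈ V ∧ normA a z < ε}

/-- The translate `C + v`. -/
def translate (C : Set (E m)) (v : E m) : Set (E m) := (fun x => x + v) '' C

/-- `y` is a solution on `[s, ∞)` of the sweeping process `-ẏ ∈ N^A_{C + c(t)}(y)`:
it is locally absolutely continuous, stays in `C + c(t)`, and satisfies the inclusion for almost
every `t ≥ s`. -/
structure IsSolution (a : Fin m → ℝ) (V : Submodule ℝ (E m)) (C : Set (E m)) (c : ℝ → E m)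
    (s : ℝ) (y : ℝ → E m) : Prop where
  absCont : ∀ r, s ≤ r → AbsolutelyContinuousOnInterval y s r
  mem : ∀ t, s ≤ t → y t ∈ translate C (c t)
  incl : ∀ᵐ t : ℝ, s ≤ t →
    ∃ v, HasDerivAt y v t ∧ -v ∈ normalCone a V (translate C (c t)) (y t)

/-- `f` is `T`-periodic on `[s, ∞)`. -/
def PeriodicFrom (f : ℝ → E m) (s T : ℝ) : Prop := ∀ t, s ≤ t → f (t + T) = f t

/-- The function `z` on `[s, ∞)` is globally one-period stable for the sweeping process with
`T`-periodic input `c`: it is Lyapunov stable, and every solution that starts at the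
beginning `k T` of a period, from an arbitrary initial value, coincides with `z` after the lapse
of one period. -/
structure GloballyOnePeriodStable (a : Fin m → ℝ) (V : Submodule ℝ (E m)) (C : Set (E m))
    (c : ℝ → E m) (T s : ℝ) (z : ℝ → E m) : Prop where
  lyapunov : ∀ t₀, s ≤ t₀ → ∀ η > 0, ∃ δ > 0, ∀ y, IsSolution a V C c t₀ y →
    normA a (y t₀ - z t₀) < δ → ∀ t, t₀ ≤ t → normA a (y t - z t) < η
  attract : ∀ (k : ℕ) (y : ℝ → E m), IsSolution a V C c (k * T) y →
    ∀ t, (k + 1) * T ≤ t → y t = z t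

end Sweeping

end

namespace Sweeping

open Filter Topology

/-! ### Decay of the norm along absolutely continuous curves. -/

section InnerProduct

variable {H : Type*} [NormedAddCommGroup H] [InnerProductSpace ℝ H]

/-! Put x = y - c - y₀. The inclusion for y, tested at y₀, gives (ẏ, x)_A ≤ 0. The hypothesis on -ċ,
tested at y - c with z tending to ε x/‖x‖, gives (-ċ, x)_A ≤ -ε‖x‖. Added up, ‖x‖ falls at speed at
least ε while it is nonzero, so x vanishes at time τd (`IsSolution.eq_vertex`).

Monotonicity of the normal cone makes the distance of two solutions nonincreasing
(`IsSolution.normA_sub_le`); this yields uniqueness and Lyapunov stability. Periodicity and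
attraction follow by time shifts.

Existence uses Moreau's catch-up scheme. Its discrete variational inequality has an error quadratic
in elapsed time, so it survives a pointwise limit, and division by the time increment gives the
inclusion wherever the limit is differentiable (`exists_sweeping_solution`). The map A^{1/2} reduces
(·,·)_A to the Euclidean product. -/

theorem _root_.LipschitzWith.comp_absolutelyContinuousOnInterval {X Y : Type*}
    [PseudoMetricSpace X] [PseudoMetricSpace Y] {K : NNReal} {g : X → Y} {f : ℝ → X} {s r : ℝ}
    (hg : LipschitzWith K g) (hf : AbsolutelyContinuousOnInterval f s r) :
    AbsolutelyContinuousOnInterval (fun t => g (f t)) s r := by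
  unfold AbsolutelyContinuousOnInterval at hf ⊢
  refine squeeze_zero (fun _ => Finset.sum_nonneg fun _ _ => dist_nonneg) (fun I => ?_)
    (by simpa using hf.const_mul (K : ℝ))
  rw [Finset.mul_sum]
  exact Finset.sum_le_sum fun i _ => hg.dist_le_mul _ _

theorem sub_le_of_ae_deriv_le {f : ℝ → ℝ} {s r M : ℝ} (hsr : s ≤ r)
    (hf : AbsolutelyContinuousOnInterval f s r)
    (hd : ∀ᵐ t : ℝ, t ∈ Icc s r → deriv f t ≤ M) : f r - f s ≤ M * (r - s) := by
  rw [← hf.integral_deriv_eq_sub]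
  have h : ∫ t in s..r, deriv f t ≤ ∫ _ in s..r, M := by
    refine intervalIntegral.integral_mono_ae_restrict hsr hf.intervalIntegrable_deriv
      intervalIntegrable_const ?_
    rw [EventuallyLE, ae_restrict_iff' measurableSet_Icc]
    exact hd
  simpa [mul_comm] using h

/-- A curve whose velocity points inwards with speed at least `κ` has nonincreasing norm and
reaches the origin after the time `‖u s‖ / κ`. -/
theorem norm_le_and_eq_zero_of_inner_deriv_le {u : ℝ → H} {s r κ : ℝ} (hsr : s ≤ r) (hκ : 0 ≤ κ)
    (hu : AbsolutelyContinuousOnInterval u s r)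
    (hd : ∀ᵐ t : ℝ, t ∈ Icc s r → ∃ v, HasDerivAt u v t ∧ inner ℝ v (u t) ≤ -(κ * ‖u t‖)) :
    ‖u r‖ ≤ ‖u s‖ ∧ (‖u s‖ ≤ κ * (r - s) → u r = 0) := by
  have hAC : ∀ p q, s ≤ p → p ≤ q → q ≤ r →
      AbsolutelyContinuousOnInterval (fun t => ‖u t‖) p q := fun p q hp hpq hq =>
    lipschitzWith_one_norm.comp_absolutelyContinuousOnInterval
      (hu.mono (by rw [uIcc_of_le hpq, uIcc_of_le hsr]; exact Icc_subset_Icc hp hq))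
  have hderiv : ∀ᵐ t : ℝ, t ∈ Icc s r →
      deriv (fun t => ‖u t‖) t ≤ 0 ∧ (u t ≠ 0 → deriv (fun t => ‖u t‖) t ≤ -κ) := by
    filter_upwards [hd] with t ht hts
    obtain ⟨v, hv, hle⟩ := ht hts
    -- The norm may fail to be differentiable where u vanishes, but such t is a minimum, so `deriv`
    -- is 0 either way.
    by_cases h0 : u t = 0
    · have hmin : IsLocalMin (fun t => ‖u t‖) t :=
        Eventually.of_forall fun x => by simp [h0]
      exact ⟨hmin.deriv_eq_zero.le, fun h => absurd h0 h⟩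
    · have hpos : 0 < ‖u t‖ := norm_pos_iff.2 h0
      have h2 := hv.norm_sq
      have h3 := h2.sqrt (by positivity)
      have heq : (fun t => √(‖u t‖ ^ 2)) = fun t => ‖u t‖ := by
        funext t; exact Real.sqrt_sq (norm_nonneg _)
      rw [heq, Real.sqrt_sq hpos.le] at h3
      have : deriv (fun t => ‖u t‖) t ≤ -κ := by
        rw [h3.deriv, div_le_iff₀ (by positivity), real_inner_comm]
        nlinarith
      exact ⟨this.trans (by linarith), fun _ => this⟩
  have hmono : ∀ p q, s ≤ p → p ≤ q → q ≤ r → ‖u q‖ ≤ ‖u p‖ := by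
    intro p q hp hpq hq
    have := sub_le_of_ae_deriv_le (M := 0) hpq (hAC p q hp hpq hq) (by
      filter_upwards [hderiv] with t ht hts
      exact (ht ⟨hp.trans hts.1, hts.2.trans hq⟩).1)
    linarith
  refine ⟨hmono s r le_rfl hsr le_rfl, fun hle => ?_⟩
  -- If u r ≠ 0, monotonicity keeps u nonzero on all of [s, r], and the rate -κ applies throughout.
  by_contra h0
  have hpos : 0 < ‖u r‖ := norm_pos_iff.2 h0
  have := sub_le_of_ae_deriv_le (M := -κ) hsr (hAC s r le_rfl hsr le_rfl) (by
      filter_upwards [hderiv] with t ht hts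
      refine (ht hts).2 fun h => ?_
      have := hmono t r hts.1 hts.2 le_rfl
      rw [h, norm_zero] at this
      linarith)
  linarith

/-- The ball is open, so the vector of length ε along w is only approached, by lengths κ < ε. -/
theorem mul_norm_le_of_forall_inner_le {w : H} {ε q : ℝ} (hε : 0 < ε)
    (h : ∀ k : ℝ, ‖k • w‖ < ε → inner ℝ (k • w) w ≤ q) : ε * ‖w‖ ≤ q := by
  by_cases hw : w = 0
  · simpa [hw] using h 0 (by simpa using hε)
  have hpos : 0 < ‖w‖ := norm_pos_iff.2 hw
  rw [← le_div_iff₀ hpos]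
  refine le_of_forall_lt_imp_le_of_dense fun κ hκ => ?_
  rcases lt_or_ge κ 0 with hneg | hnn
  · have := h 0 (by simpa using hε)
    simp only [zero_smul, inner_zero_left] at this
    exact hneg.le.trans (by positivity)
  · have := h (κ / ‖w‖) (by
      rw [norm_smul, Real.norm_of_nonneg (by positivity), div_mul_cancel₀ _ hpos.ne']
      exact hκ)
    rw [real_inner_smul_left, real_inner_self_eq_norm_sq] at this
    rw [le_div_iff₀ hpos]
    calc κ * ‖w‖ = κ / ‖w‖ * ‖w‖ ^ 2 := by field_simp
      _ ≤ q := this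

/-! ### Existence for a moving convex set. -/

/-- The catch-up scheme with step `h`, read as a piecewise constant function. -/
theorem exists_catchUp [CompleteSpace H] {K : Set H} (hKc : IsClosed K) (hK : Convex ℝ K)
    {L : NNReal} {c : ℝ → H} (hc : LipschitzWith L c) (s : ℝ) {x₀ : H} (hx₀ : x₀ ∈ K)
    {h : ℝ} (hh : 0 < h) :
    ∃ (f : ℝ → H) (p : ℝ → ℝ), f s = x₀ + c s ∧ (∀ t, s ≤ t → |p t - t| ≤ h) ∧
      (∀ t, f t - c (p t) ∈ K) ∧
      ∀ t t', s ≤ t → t ≤ t' → ‖f t' - f t‖ ≤ L * (t' - t + h) ∧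
        ∀ ξ ∈ K, -(2 * L ^ 2 * (t' - t + h) ^ 2) ≤ inner ℝ (f t' - f t) (ξ - (f t - c (p t))) := by
  have hproj : ∀ u : H, ∃ v ∈ K, (∀ w ∈ K, ‖u - v‖ ≤ ‖u - w‖) ∧
      ∀ w ∈ K, inner ℝ (u - v) (w - v) ≤ 0 := by
    intro u
    obtain ⟨v, hv, heq⟩ := exists_norm_eq_iInf_of_complete_convex ⟨x₀, hx₀⟩ hKc.isComplete hK u
    refine ⟨v, hv, fun w hw => ?_, (norm_eq_iInf_iff_real_inner_le_zero hK hv).1 heq⟩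
    rw [heq]
    exact ciInf_le (f := fun w : K => ‖u - w‖)
      ⟨0, forall_mem_range.2 fun _ => norm_nonneg _⟩ ⟨w, hw⟩
  choose P hPK hPmin hPin using hproj
  let τ : ℕ → ℝ := fun i => s + i * h
  let w : ℕ → H := fun i =>
    Nat.rec (x₀ + c s) (fun i z => c (τ (i + 1)) + P (z - c (τ (i + 1)))) i
  have hw0 : w 0 = x₀ + c s := rfl
  have hws : ∀ i, w (i + 1) = c (τ (i + 1)) + P (w i - c (τ (i + 1))) := fun _ => rfl
  have hmem : ∀ i, w i - c (τ i) ∈ K := by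
    intro i
    cases i with
    | zero => simpa [hw0, τ] using hx₀
    | succ i => rw [hws, add_sub_cancel_left]; exact hPK _
  have hcτ : ∀ i k : ℕ, ‖c (τ (i + k)) - c (τ i)‖ ≤ L * (k * h) := by
    intro i k
    have := hc.dist_le_mul (τ (i + k)) (τ i)
    rw [dist_eq_norm, Real.dist_eq] at this
    have e : τ (i + k) - τ i = k * h := by simp only [τ]; push_cast; ring
    rwa [e, abs_of_nonneg (by positivity)] at this
  -- The old relative position still lies in K, so the projection moves no farther than c did.
  have hstep : ∀ i, ‖w (i + 1) - w i‖ ≤ L * h := by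
    intro i
    have h1 := hPmin (w i - c (τ (i + 1))) _ (hmem i)
    have h2 := hcτ i 1
    rw [sub_sub_sub_cancel_left, ← norm_neg, neg_sub] at h1
    have h3 : ‖w (i + 1) - w i‖ = ‖P (w i - c (τ (i + 1))) - (w i - c (τ (i + 1)))‖ := by
      rw [hws]; congr 1; abel
    have h4 := hcτ i 1
    rw [h3]
    rw [norm_sub_rev (c (τ i))] at h1
    simpa using h1.trans h4
  have hvar : ∀ i, ∀ ξ ∈ K, 0 ≤ inner ℝ (w (i + 1) - w i) (ξ - (w (i + 1) - c (τ (i + 1)))) := by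
    intro i ξ hξ
    have h1 := hPin (w i - c (τ (i + 1))) ξ hξ
    have e1 : w (i + 1) - w i = -(w i - c (τ (i + 1)) - P (w i - c (τ (i + 1)))) := by
      rw [hws]; abel
    have e2 : w (i + 1) - c (τ (i + 1)) = P (w i - c (τ (i + 1))) := by
      rw [hws]; abel
    rw [e2, e1, inner_neg_left]
    linarith
  have hdist : ∀ i k : ℕ, ‖w (i + k) - w i‖ ≤ L * (k * h) := by
    intro i k
    induction k with
    | zero => simp
    | succ k ih =>
      have e : w (i + (k + 1)) - w i = (w (i + k + 1) - w (i + k)) + (w (i + k) - w i) := by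
        rw [← add_assoc]; abel
      rw [e]
      refine (norm_add_le _ _).trans ((add_le_add (hstep _) ih).trans (le_of_eq ?_))
      push_cast; ring
  -- Replacing the current relative position by the initial one costs at most Lh · 2L(k+1)h at each
  -- step; these costs sum to at most 2L²(kh)².
  have hineq : ∀ i k : ℕ, ∀ ξ ∈ K,
      -(2 * L ^ 2 * (k * h) ^ 2) ≤ inner ℝ (w (i + k) - w i) (ξ - (w i - c (τ i))) := by
    intro i k ξ hξ
    induction k with
    | zero => simp
    | succ k ih =>
      have e : w (i + (k + 1)) - w i = (w (i + k + 1) - w (i + k)) + (w (i + k) - w i) := by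
        rw [← add_assoc]; abel
      have e2 : ξ - (w i - c (τ i)) = (ξ - (w (i + k + 1) - c (τ (i + k + 1)))) +
          ((w (i + (k + 1)) - w i) - (c (τ (i + (k + 1))) - c (τ i))) := by
        rw [← add_assoc]; abel
      have h1 := hvar (i + k) ξ hξ
      have h2 : -(L * h * (2 * (L * ((k + 1 : ℕ) * h)))) ≤ inner ℝ (w (i + k + 1) - w (i + k))
          ((w (i + (k + 1)) - w i) - (c (τ (i + (k + 1))) - c (τ i))) := by
        refine neg_le_of_abs_le ((abs_real_inner_le_norm _ _).trans ?_)
        refine mul_le_mul (hstep _) ?_ (norm_nonneg _) (by positivity)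
        refine (norm_sub_le _ _).trans ?_
        linarith [hdist i (k + 1), hcτ i (k + 1)]
      have h3 : inner ℝ (w (i + k + 1) - w (i + k)) (ξ - (w i - c (τ i))) =
          inner ℝ (w (i + k + 1) - w (i + k)) (ξ - (w (i + k + 1) - c (τ (i + k + 1)))) +
          inner ℝ (w (i + k + 1) - w (i + k))
            ((w (i + (k + 1)) - w i) - (c (τ (i + (k + 1))) - c (τ i))) := by
        rw [← inner_add_right, ← e2]
      rw [e, inner_add_left, h3]
      have h4 : 0 ≤ (L : ℝ) ^ 2 * h ^ 2 * k := by positivity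
      push_cast at h2 ⊢
      nlinarith
  let N : ℝ → ℕ := fun t => ⌊(t - s) / h⌋₊
  have hN1 : ∀ t, s ≤ t → N t * h ≤ t - s := fun t ht => by
    rw [← le_div_iff₀ hh]
    exact Nat.floor_le (div_nonneg (by linarith) hh.le)
  have hN2 : ∀ t, t - s < N t * h + h := fun t => by
    have := Nat.lt_floor_add_one ((t - s) / h)
    rw [div_lt_iff₀ hh] at this
    simp only [N]; linarith
  refine ⟨fun t => w (N t), fun t => τ (N t), by simp [N, hw0], fun t ht => ?_, fun t => hmem _, ?_⟩
  · have := hN1 t ht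
    have := hN2 t
    simp only [τ]
    rw [abs_le]; constructor <;> linarith
  · intro t t' ht htt'
    have hle : N t ≤ N t' := Nat.floor_le_floor (div_le_div_of_nonneg_right (by linarith) hh.le)
    obtain ⟨k, hk⟩ := Nat.exists_eq_add_of_le hle
    have hkh : (k : ℝ) * h ≤ t' - t + h := by
      have h1 := hN1 t' (ht.trans htt')
      have h2 := hN2 t
      rw [hk] at h1
      push_cast at h1
      linarith
    have hk0 : 0 ≤ (k : ℝ) * h := by positivity
    constructor
    · simp only [hk]
      exact (hdist _ _).trans (by gcongr)
    · intro ξ hξ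
      simp only [hk]
      refine le_trans ?_ (hineq _ _ ξ hξ)
      gcongr

/-- A pointwise limit of the catch-up schemes. -/
theorem exists_catchUp_limit [FiniteDimensional ℝ H] {K : Set H} (hKc : IsClosed K)
    (hK : Convex ℝ K) {L : NNReal} {c : ℝ → H} (hc : LipschitzWith L c) (s : ℝ) {x₀ : H}
    (hx₀ : x₀ ∈ K) :
    ∃ y : ℝ → H, y s = x₀ + c s ∧ (∀ t, s ≤ t → y t - c t ∈ K) ∧
      ∀ t t', s ≤ t → t ≤ t' → ‖y t' - y t‖ ≤ L * (t' - t) ∧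
        ∀ ξ ∈ K, -(2 * L ^ 2 * (t' - t) ^ 2) ≤ inner ℝ (y t' - y t) (ξ - (y t - c t)) := by
  have := FiniteDimensional.complete ℝ H
  have := FiniteDimensional.proper_real H
  have hpos : ∀ n : ℕ, (0 : ℝ) < 1 / (n + 1) := fun n => by positivity
  choose f p hf0 hp hfK hf using fun n : ℕ => exists_catchUp hKc hK hc s hx₀ (hpos n)
  -- Along an ultrafilter, boundedness gives convergence at every t at once, without extracting
  -- subsequences.
  let U : Ultrafilter ℕ := Ultrafilter.of atTop
  have hU : (U : Filter ℕ) ≤ atTop := Ultrafilter.of_le _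
  have hstep : Tendsto (fun n : ℕ => (1 : ℝ) / (n + 1)) U (𝓝 0) :=
    tendsto_one_div_add_atTop_nhds_zero_nat.mono_left hU
  have hlim : ∀ t, ∃ z, s ≤ t → Tendsto (fun n => f n t) U (𝓝 z) := by
    intro t
    by_cases ht : s ≤ t
    · have hb : ∀ n, f n t ∈ Metric.closedBall (x₀ + c s) (L * (t - s + 1)) := by
        intro n
        rw [mem_closedBall_iff_norm, ← hf0 n]
        refine ((hf n s t le_rfl ht).1).trans ?_
        gcongr
        rw [div_le_one (by positivity)]
        linarith [n.cast_nonneg (α := ℝ)]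
      obtain ⟨z, -, hz⟩ := (isCompact_closedBall (x₀ + c s) (L * (t - s + 1))).ultrafilter_le_nhds
        (U.map fun n => f n t) (le_principal_iff.2 (mem_map.2 (Eventually.of_forall hb)))
      exact ⟨z, fun _ => hz⟩
    · exact ⟨0, fun h => absurd h ht⟩
  choose y hy using hlim
  have hpt : ∀ t, s ≤ t → Tendsto (fun n => c (p n t)) U (𝓝 (c t)) := by
    intro t ht
    refine (hc.continuous.tendsto t).comp ?_
    rw [tendsto_iff_dist_tendsto_zero]
    exact squeeze_zero (fun _ => dist_nonneg) (fun n => hp n t ht) hstep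
  have hx : ∀ t, s ≤ t → Tendsto (fun n => f n t - c (p n t)) U (𝓝 (y t - c t)) :=
    fun t ht => (hy t ht).sub (hpt t ht)
  refine ⟨y, ?_, fun t ht => ?_, fun t t' ht htt' => ⟨?_, fun ξ hξ => ?_⟩⟩
  · refine tendsto_nhds_unique (hy s le_rfl) ?_
    simp only [hf0]
    exact tendsto_const_nhds
  · exact hKc.mem_of_tendsto (hx t ht) (Eventually.of_forall fun n => hfK n t)
  · have hr : Tendsto (fun n : ℕ => (L : ℝ) * (t' - t + 1 / (n + 1))) U (𝓝 (L * (t' - t + 0))) :=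
      (hstep.const_add _).const_mul _
    rw [add_zero] at hr
    exact le_of_tendsto_of_tendsto ((hy t' (ht.trans htt')).sub (hy t ht)).norm hr
      (Eventually.of_forall fun n => (hf n t t' ht htt').1)
  · have hr : Tendsto (fun n : ℕ => -(2 * (L : ℝ) ^ 2 * (t' - t + 1 / (n + 1)) ^ 2)) U
        (𝓝 (-(2 * L ^ 2 * (t' - t + 0) ^ 2))) :=
      (((hstep.const_add _).pow 2).const_mul _).neg
    rw [add_zero] at hr
    exact le_of_tendsto_of_tendsto hr
      (((hy t' (ht.trans htt')).sub (hy t ht)).inner ((hx t ht).const_sub ξ))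
      (Eventually.of_forall fun n => (hf n t t' ht htt').2 ξ hξ)

/-- The scheme gives forward estimates only, so right slopes are used; the quadratic error vanishes
after division. -/
theorem inner_deriv_nonneg_of_le_inner_sub {y : ℝ → H} {v ζ : H} {t M : ℝ} (hv : HasDerivAt y v t)
    (h : ∀ t', t ≤ t' → -(M * (t' - t) ^ 2) ≤ inner ℝ (y t' - y t) ζ) : 0 ≤ inner ℝ v ζ := by
  have h1 := ((hasDerivAt_iff_tendsto_slope_left_right.1 hv).2).inner (𝕜 := ℝ)
    (tendsto_const_nhds (x := ζ))
  have h2 : Tendsto (fun t' => -(M * (t' - t))) (𝓝[>] t) (𝓝 0) := by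
    have : Continuous fun t' : ℝ => -(M * (t' - t)) := by fun_prop
    simpa using (this.tendsto t).mono_left nhdsWithin_le_nhds
  refine le_of_tendsto_of_tendsto h2 h1 ?_
  filter_upwards [self_mem_nhdsWithin] with t' ht'
  have hpos : 0 < t' - t := sub_pos.2 ht'
  rw [slope_def_module, real_inner_smul_left, ← div_eq_inv_mul, le_div_iff₀ hpos]
  linarith [h t' ht'.le]

theorem exists_sweeping_solution [FiniteDimensional ℝ H] {K : Set H} (hKc : IsClosed K)
    (hK : Convex ℝ K) {L : NNReal} {c : ℝ → H} (hc : LipschitzWith L c) (s : ℝ) {x₀ : H}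
    (hx₀ : x₀ ∈ K) :
    ∃ y : ℝ → H, LipschitzWith L y ∧ y s = x₀ + c s ∧ (∀ t, s ≤ t → y t - c t ∈ K) ∧
      ∀ᵐ t : ℝ, s ≤ t → ∃ v, HasDerivAt y v t ∧ ∀ ξ ∈ K, 0 ≤ inner ℝ v (ξ - (y t - c t)) := by
  obtain ⟨y, hy0, hyK, hy⟩ := exists_catchUp_limit hKc hK hc s hx₀
  have hmax : ∀ t, s ≤ t → y (max t s) = y t := fun t ht => by rw [max_eq_left ht]
  -- Freezing y before s makes it Lipschitz on ℝ, hence differentiable almost everywhere.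
  have hLip : LipschitzWith L fun t => y (max t s) := by
    have key : ∀ t t', t ≤ t' → ‖y (max t' s) - y (max t s)‖ ≤ L * |t' - t| := by
      intro t t' htt'
      refine ((hy _ _ (le_max_right t s) (max_le_max_right s htt')).1).trans ?_
      gcongr
      exact (le_abs_self _).trans (abs_max_sub_max_le_abs t' t s)
    refine LipschitzWith.of_dist_le_mul fun t t' => ?_
    rw [Real.dist_eq, dist_eq_norm]
    rcases le_total t t' with h | h
    · rw [norm_sub_rev, abs_sub_comm]; exact key t t' h
    · exact key t' t h
  refine ⟨fun t => y (max t s), hLip, by simp [hy0], fun t ht => ?_, ?_⟩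
  · simpa only [hmax t ht] using hyK t ht
  · filter_upwards [hLip.ae_differentiableAt_real] with t hdiff ht
    refine ⟨_, hdiff.hasDerivAt, fun ξ hξ => ?_⟩
    refine inner_deriv_nonneg_of_le_inner_sub (M := 2 * L ^ 2) hdiff.hasDerivAt fun t' ht' => ?_
    simpa only [hmax t ht, hmax t' (ht.trans ht')] using (hy t t' ht ht').2 ξ hξ

end InnerProduct

/-! ### Time shifts and transfer to the weighted scalar product. -/

variable {m : ℕ}

theorem _root_.AbsolutelyContinuousOnInterval.comp_add_right {X : Type*} [PseudoMetricSpace X]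
    {f : ℝ → X} {s r T : ℝ} (hf : AbsolutelyContinuousOnInterval f (s + T) (r + T)) :
    AbsolutelyContinuousOnInterval (fun t => f (t + T)) s r := by
  rw [absolutelyContinuousOnInterval_iff] at hf ⊢
  intro ε hε
  obtain ⟨δ, hδ, h⟩ := hf ε hε
  refine ⟨δ, hδ, fun I hI hlen => ?_⟩
  refine h (I.1, fun i => ((I.2 i).1 + T, (I.2 i).2 + T)) ⟨fun i hi => ?_, ?_⟩ (by simpa using hlen)
  · have := hI.1 i hi
    simp only [mem_uIcc] at this ⊢
    grind
  · intro i hi j hj hij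
    have := hI.2 hi hj hij
    simp only [Function.onFun, Set.disjoint_left, mem_uIoc] at this ⊢
    intro x hx hx'
    exact this (a := x - T) (by grind) (by grind)

/-- The scheme runs in the whole space, while `normalCone` asks for velocities in V. -/
theorem _root_.HasDerivAt.mem_submodule {F : Type*} [NormedAddCommGroup F] [NormedSpace ℝ F]
    [FiniteDimensional ℝ F] {V : Submodule ℝ F} {y : ℝ → F} {v : F} {t : ℝ}
    (hv : HasDerivAt y v t) (h : ∀ t', t ≤ t' → y t' ∈ V) : v ∈ V := by
  refine V.closed_of_finiteDimensional.mem_of_tendsto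
    (hasDerivAt_iff_tendsto_slope_left_right.1 hv).2 ?_
  filter_upwards [self_mem_nhdsWithin] with t' ht'
  rw [slope_def_module]
  exact V.smul_mem _ (V.sub_mem (h t' (le_of_lt ht')) (h t le_rfl))

/-- The linear isomorphism `A^{1/2}`, which carries `(·, ·)_A` to the Euclidean scalar product. -/
noncomputable def sqrtDiag (a : Fin m → ℝ) (ha : ∀ j, 0 < a j) : E m ≃L[ℝ] E m :=
  LinearEquiv.toContinuousLinearEquiv
    { toFun := fun x => WithLp.toLp 2 fun j => √(a j) * x j
      invFun := fun x => WithLp.toLp 2 fun j => (√(a j))⁻¹ * x j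
      map_add' := fun x y => by ext j; simp [mul_add]
      map_smul' := fun k x => by ext j; simp; ring
      left_inv := fun x => by
        ext j; simp [inv_mul_cancel_left₀ (Real.sqrt_pos.2 (ha j)).ne']
      right_inv := fun x => by
        ext j; simp [mul_inv_cancel_left₀ (Real.sqrt_pos.2 (ha j)).ne'] }

variable {a : Fin m → ℝ} (ha : ∀ j, 0 < a j) {V : Submodule ℝ (E m)} {C : Set (E m)}
  {c : ℝ → E m}

theorem sqrtDiag_apply (x : E m) (j : Fin m) : sqrtDiag a ha x j = √(a j) * x j := rfl

theorem inner_sqrtDiag (x y : E m) :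
    inner ℝ (sqrtDiag a ha x) (sqrtDiag a ha y) = scalarA a x y := by
  rw [PiLp.inner_apply, scalarA]
  refine Finset.sum_congr rfl fun j _ => ?_
  rw [sqrtDiag_apply, sqrtDiag_apply]
  have := Real.mul_self_sqrt (ha j).le
  simp only [RCLike.inner_apply, conj_trivial]
  linear_combination (x j * y j) * this

theorem norm_sqrtDiag (x : E m) : ‖sqrtDiag a ha x‖ = normA a x := by
  rw [normA, ← inner_sqrtDiag ha, real_inner_self_eq_norm_sq, Real.sqrt_sq (norm_nonneg _)]

theorem mem_translate_iff {C : Set (E m)} {v y : E m} : y ∈ translate C v ↔ y - v ∈ C :=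
  ⟨by rintro ⟨x, hx, rfl⟩; simpa using hx, fun h => ⟨y - v, h, by simp⟩⟩

theorem neg_mem_normalCone_translate_iff {v w y : E m} :
    -v ∈ normalCone a V (translate C w) y ↔
      y - w ∈ C ∧ v ∈ V ∧ ∀ ξ ∈ C,
        0 ≤ inner ℝ (sqrtDiag a ha v) (sqrtDiag a ha ξ - sqrtDiag a ha (y - w)) := by
  simp only [normalCone, mem_ofPred_eq, mem_translate_iff, V.neg_mem_iff]
  refine and_congr_right fun _ => and_congr_right fun _ => ?_
  have key : ∀ ξ : E m, scalarA a (-v) (ξ - y) = -inner ℝ (sqrtDiag a ha v)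
      (sqrtDiag a ha (ξ - w) - sqrtDiag a ha (y - w)) := fun ξ => by
    rw [← inner_sqrtDiag ha, map_neg, inner_neg_left, ← map_sub, sub_sub_sub_cancel_right]
  constructor
  · intro h ξ hξ
    have := h (ξ + w) (by simpa using hξ)
    rw [key, add_sub_cancel_right] at this
    linarith
  · intro h ξ hξ
    rw [key]
    linarith [h _ hξ]

/-! ### Contraction, existence and finite-time convergence. -/

include ha in
theorem IsSolution.normA_sub_le {s r : ℝ} {y z : ℝ → E m} (hy : IsSolution a V C c s y)
    (hz : IsSolution a V C c s z) (hsr : s ≤ r) : normA a (y r - z r) ≤ normA a (y s - z s) := by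
  simp only [← norm_sqrtDiag ha]
  refine (norm_le_and_eq_zero_of_inner_deriv_le (u := fun t => sqrtDiag a ha (y t - z t)) hsr le_rfl
    ((sqrtDiag a ha).lipschitz.comp_absolutelyContinuousOnInterval
      ((hy.absCont r hsr).sub (hz.absCont r hsr))) ?_).1
  filter_upwards [hy.incl, hz.incl] with t h1 h2 ht
  obtain ⟨v, hv, hvN⟩ := h1 ht.1
  obtain ⟨w, hw, hwN⟩ := h2 ht.1
  rw [neg_mem_normalCone_translate_iff ha] at hvN hwN
  refine ⟨_, (sqrtDiag a ha).hasFDerivAt.comp_hasDerivAt t (hv.sub hw), ?_⟩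
  -- Each inclusion is tested at the other solution's position relative to c.
  have h3 := hvN.2.2 _ hwN.1
  have h4 := hwN.2.2 _ hvN.1
  simp only [ContinuousLinearEquiv.coe_coe, map_sub, inner_sub_left, inner_sub_right] at h3 h4 ⊢
  linarith

include ha in
theorem IsSolution.eqOn {s : ℝ} {y z : ℝ → E m} (hy : IsSolution a V C c s y)
    (hz : IsSolution a V C c s z) (h : y s = z s) : EqOn y z (Ici s) := by
  intro r hr
  have := hy.normA_sub_le ha hz hr
  rw [h, sub_self, ← norm_sqrtDiag ha, ← norm_sqrtDiag ha, map_zero, norm_zero] at this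
  exact sub_eq_zero.1 ((map_eq_zero_iff _ (sqrtDiag a ha).injective).1 (norm_le_zero_iff.1 this))

theorem IsSolution.mono {s s' : ℝ} {y : ℝ → E m} (hy : IsSolution a V C c s y) (hs : s ≤ s') :
    IsSolution a V C c s' y where
  absCont r hr := (hy.absCont r (hs.trans hr)).mono (by
    rw [uIcc_of_le hr, uIcc_of_le (hs.trans hr)]; exact Icc_subset_Icc_left hs)
  mem t ht := hy.mem t (hs.trans ht)
  incl := by filter_upwards [hy.incl] with t h ht using h (hs.trans ht)

theorem IsSolution.comp_add_right {s T : ℝ} {y : ℝ → E m} (hy : IsSolution a V C c (s + T) y)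
    (hc : ∀ t, s ≤ t → c (t + T) = c t) : IsSolution a V C c s fun t => y (t + T) where
  absCont r hr := (hy.absCont (r + T) (by linarith)).comp_add_right
  mem t ht := by simpa only [hc t ht] using hy.mem (t + T) (by linarith)
  incl := by
    filter_upwards [(measurePreserving_add_right volume T).quasiMeasurePreserving.ae hy.incl]
      with t h ht
    obtain ⟨v, hv, hvN⟩ := h (by linarith)
    rw [hc t ht] at hvN
    exact ⟨v, hv.comp_add_const t T, hvN⟩

theorem exists_lipschitzWith_eqOn_Ici {X : Type*} [PseudoMetricSpace X] {f : ℝ → X} {K : NNReal}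
    {s : ℝ} (hf : LipschitzOnWith K f (Ici s)) : ∃ g, LipschitzWith K g ∧ EqOn g f (Ici s) :=
  ⟨fun t => f (max t s), LipschitzWith.of_dist_le_mul fun t t' =>
      (hf.dist_le_mul _ (le_max_right t s) _ (le_max_right t' s)).trans (by
        gcongr; exact abs_max_sub_max_le_abs t t' s),
    fun t ht => by simp only [max_eq_left (mem_Ici.1 ht)]⟩

include ha in
theorem exists_isSolution (hC : IsClosed C) (hconv : Convex ℝ C) (hCV : C ⊆ V)
    (hcV : ∀ t, 0 ≤ t → c t ∈ V) {K : NNReal} (hc : LipschitzOnWith K c (Ici 0)) {s : ℝ}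
    (hs : 0 ≤ s) {x₀ : E m} (hx₀ : x₀ ∈ C) :
    ∃ y, IsSolution a V C c s y ∧ y s = x₀ + c s := by
  obtain ⟨g, hg, hgc⟩ := exists_lipschitzWith_eqOn_Ici hc
  have hgc' : ∀ t, s ≤ t → g t = c t := fun t ht => hgc (hs.trans ht)
  let S := sqrtDiag a ha
  obtain ⟨y, hyL, hy0, hyK, hy⟩ := exists_sweeping_solution (K := S '' C) (c := fun t => S (g t))
    (S.toHomeomorph.isClosedMap _ hC) (hconv.linear_image S.toLinearEquiv.toLinearMap)
    (S.lipschitz.comp hg) s (mem_image_of_mem S hx₀)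
  have hmem : ∀ t, s ≤ t → S.symm (y t) - c t ∈ C := by
    intro t ht
    obtain ⟨x, hx, hxe⟩ := hyK t ht
    have : S.symm (y t) = x + c t := by
      rw [S.symm_apply_eq, map_add, hxe, hgc' t ht]; abel
    rwa [this, add_sub_cancel_right]
  refine ⟨fun t => S.symm (y t), ⟨fun r hr => ?_, fun t ht => ?_, ?_⟩, ?_⟩
  · exact (S.symm.lipschitz.comp hyL).lipschitzOnWith.absolutelyContinuousOnInterval
  · exact mem_translate_iff.2 (hmem t ht)
  · filter_upwards [hy] with t h ht
    obtain ⟨v, hv, hvN⟩ := h ht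
    have hv' : HasDerivAt (fun t => S.symm (y t)) (S.symm v) t :=
      S.symm.hasFDerivAt.comp_hasDerivAt t hv
    refine ⟨S.symm v, hv', (neg_mem_normalCone_translate_iff ha).2 ⟨hmem t ht, ?_, ?_⟩⟩
    · refine hv'.mem_submodule fun t' ht' => ?_
      have := V.add_mem (hCV (hmem t' (ht.trans ht'))) (hcV t' (hs.trans (ht.trans ht')))
      rwa [sub_add_cancel] at this
    · intro ξ hξ
      have := hvN _ (mem_image_of_mem S hξ)
      rw [hgc' t ht] at this
      change 0 ≤ inner ℝ (S (S.symm v)) (S ξ - S (S.symm (y t) - c t))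
      rwa [map_sub, S.apply_symm_apply, S.apply_symm_apply]
  · change S.symm (y s) = _
    rw [S.symm_apply_eq, hy0, map_add, hgc' s le_rfl]

include ha in
/-- Finite-time convergence to the vertex `y₀ + c`. -/
theorem IsSolution.eq_vertex {y : ℝ → E m} {y₀ : E m} {ε τ : ℝ} (hy : IsSolution a V C c 0 y)
    (hCV : C ⊆ V) {K : NNReal} (hc : LipschitzOnWith K c (Ici 0)) (hy₀ : y₀ ∈ C) (hε : 0 < ε)
    (hτ : ∀ v ∈ C, 1 / ε * normA a (v - y₀) ≤ τ)
    (hN : ∀ᵐ t : ℝ, t ∈ Icc 0 τ → ∀ z ∈ ballA a V ε, -deriv c t + z ∈ normalCone a V C y₀) :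
    y τ = y₀ + c τ := by
  have hy0 := mem_translate_iff.1 (hy.mem 0 le_rfl)
  have hτ0 : 0 ≤ τ := le_trans (by rw [normA]; positivity) (hτ _ hy₀)
  let S := sqrtDiag a ha
  obtain ⟨g, hg, hgc⟩ := exists_lipschitzWith_eqOn_Ici hc
  have hcAC : AbsolutelyContinuousOnInterval c 0 τ :=
    (hc.mono (by rw [uIcc_of_le hτ0]; exact Icc_subset_Ici_self)).absolutelyContinuousOnInterval
  have hcd : ∀ᵐ t : ℝ, 0 ≤ t → HasDerivAt c (deriv c t) t := by
    -- At 0 the derivative of c would involve its uncontrolled values at negative times.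
    have h0 : ∀ᵐ t : ℝ, t ≠ 0 := by simp [ae_iff]
    filter_upwards [hg.ae_differentiableAt_real, h0] with t h h0 ht
    have hev : c =ᶠ[𝓝 t] g := by
      filter_upwards [Ioi_mem_nhds (lt_of_le_of_ne ht h0.symm)] with t' ht'
      exact (hgc (mem_Ici.2 (le_of_lt ht'))).symm
    exact (h.congr_of_eventuallyEq hev).hasDerivAt
  have hAC : AbsolutelyContinuousOnInterval (fun t => S (y t - c t - y₀)) 0 τ := by
    refine S.lipschitz.comp_absolutelyContinuousOnInterval ?_
    refine AbsolutelyContinuousOnInterval.fun_sub ((hy.absCont τ hτ0).fun_sub hcAC) ?_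
    exact (LipschitzWith.const y₀).lipschitzOnWith.absolutelyContinuousOnInterval
  have hdec := norm_le_and_eq_zero_of_inner_deriv_le hτ0 hε.le hAC (by
    filter_upwards [hy.incl, hcd, hN] with t h1 h2 h3 ht
    obtain ⟨v, hv, hvN⟩ := h1 ht.1
    refine ⟨_, S.hasFDerivAt.comp_hasDerivAt t ((hv.sub (h2 ht.1)).sub_const y₀), ?_⟩
    rw [neg_mem_normalCone_translate_iff ha] at hvN
    obtain ⟨hxC, -, hvN⟩ := hvN
    rw [le_neg]
    refine mul_norm_le_of_forall_inner_le hε fun k hk => ?_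
    rw [← map_smul, norm_sqrtDiag] at hk
    have h4 := (h3 ht (k • (y t - c t - y₀))
      ⟨V.smul_mem _ (V.sub_mem (hCV hxC) (hCV hy₀)), hk⟩).2.2 _ hxC
    have h5 := hvN _ hy₀
    rw [← inner_sqrtDiag ha] at h4
    simp only [S, ContinuousLinearEquiv.coe_coe, map_sub, map_add, map_neg, map_smul,
      inner_add_left, inner_neg_left, inner_sub_left, inner_sub_right] at h4 h5 ⊢
    linarith)
  have h0 := hdec.2 (by
    have h := hτ _ hy0
    rw [one_div, inv_mul_le_iff₀ hε] at h
    simpa only [S, norm_sqrtDiag ha, sub_zero] using h)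
  have := (map_eq_zero_iff _ S.injective).1 h0
  rw [sub_sub, sub_eq_zero] at this
  rw [this, add_comm]

/-! ### The polyhedron and the final theorem. -/

theorem convex_polyhedron (b : ℤˣ → Fin m → ℝ) : Convex ℝ (polyhedron a V b) := by
  intro x hx y hy p q hp hq hpq
  refine ⟨V.add_mem (V.smul_mem _ hx.1) (V.smul_mem _ hy.1), fun j => ?_⟩
  have key : ∀ α : ℤˣ, x ∈ halfSpace a V b α j → y ∈ halfSpace a V b α j →
      p • x + q • y ∈ halfSpace a V b α j := by
    intro α hx hy
    refine ⟨V.add_mem (V.smul_mem _ hx.1) (V.smul_mem _ hy.1), ?_⟩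
    have e : ∀ w : E m, scalarA a w (p • x + q • y) = p * scalarA a w x + q * scalarA a w y := by
      intro w
      simp only [scalarA, Finset.mul_sum, ← Finset.sum_add_distrib]
      exact Finset.sum_congr rfl fun i _ => by simp; ring
    rw [e]
    have h1 := mul_le_mul_of_nonneg_left hx.2 hp
    have h2 := mul_le_mul_of_nonneg_left hy.2 hq
    refine (add_le_add h1 h2).trans (le_of_eq ?_)
    rw [← add_mul, hpq, one_mul]
  exact ⟨key _ (hx.2 j).1 (hy.2 j).1, key _ (hx.2 j).2 (hy.2 j).2⟩

theorem isClosed_polyhedron (b : ℤˣ → Fin m → ℝ) : IsClosed (polyhedron a V b) := by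
  have hV : IsClosed {y : E m | y ∈ V} := V.closed_of_finiteDimensional
  have hH : ∀ α j, IsClosed (halfSpace a V b α j) := fun α j =>
    hV.inter (isClosed_le (f := fun y => scalarA a _ y)
      (by simp only [scalarA]; fun_prop) continuous_const)
  have : polyhedron a V b =
      {y | y ∈ V} ∩ ⋂ j, (halfSpace a V b (-1) j ∩ halfSpace a V b 1 j) := by
    ext y; simp [polyhedron]
  rw [this]
  exact hV.inter (isClosed_iInter fun j => (hH _ j).inter (hH _ j))

end Sweeping

theorem corollary1 {m : ℕ} (a : Fin m → ℝ) (ha : ∀ j, 0 < a j)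
    (V : Submodule ℝ (Sweeping.E m)) (b : ℤˣ → Fin m → ℝ)
    (c : ℝ → Sweeping.E m) (hcV : ∀ t, 0 ≤ t → c t ∈ V)
    (hcLip : ∃ K, LipschitzOnWith K c (Set.Ici 0))
    (I₀ : Finset (ℤˣ × Fin m)) (y₀ : Sweeping.E m)
    (hvertex : Sweeping.face a V b I₀ = {y₀})
    (hfeasible : y₀ ∈ Sweeping.polyhedron a V b)
    (ε τd : ℝ) (hε : 0 < ε)
    (hτd : IsGreatest
      ((fun v => (1 / ε) * Sweeping.normA a (v - y₀)) '' Sweeping.polyhedron a V b) τd)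
    (hA0 : ∀ᵐ t : ℝ, t ∈ Set.Icc 0 τd → ∀ z ∈ Sweeping.ballA a V ε,
      -deriv c t + z ∈ Sweeping.normalCone a V (Sweeping.polyhedron a V b) y₀) :
    (∀ y : ℝ → Sweeping.E m,
      Sweeping.IsSolution a V (Sweeping.polyhedron a V b) c 0 y →
      y 0 ∈ Sweeping.translate (Sweeping.polyhedron a V b) (c 0) →
      y τd = y₀ + c τd) ∧
    ∃ ys : ℝ → Sweeping.E m,
      Sweeping.IsSolution a V (Sweeping.polyhedron a V b) c τd ys ∧
      ys τd = y₀ + c τd ∧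
      (∀ y : ℝ → Sweeping.E m,
        Sweeping.IsSolution a V (Sweeping.polyhedron a V b) c τd y →
        y τd = y₀ + c τd → Set.EqOn y ys (Set.Ici τd)) ∧
      ∀ T : ℝ, 0 < T → τd ≤ T → Sweeping.PeriodicFrom c 0 T →
        Sweeping.PeriodicFrom ys τd T ∧
        Sweeping.GloballyOnePeriodStable a V (Sweeping.polyhedron a V b) c T τd ys := by
  obtain ⟨K, hc⟩ := hcLip
  set C := Sweeping.polyhedron a V b
  have hCV : C ⊆ V := fun y hy => hy.1
  have hτ : ∀ v ∈ C, 1 / ε * Sweeping.normA a (v - y₀) ≤ τd := fun v hv =>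
    hτd.2 (Set.mem_image_of_mem _ hv)
  have hτ0 : 0 ≤ τd := le_trans (by rw [Sweeping.normA]; positivity) (hτ _ hfeasible)
  have hvert : ∀ y, Sweeping.IsSolution a V C c 0 y → y τd = y₀ + c τd := fun y hy =>
    hy.eq_vertex ha hCV hc hfeasible hε hτ hA0
  obtain ⟨ys, hys, hys0⟩ := Sweeping.exists_isSolution ha (Sweeping.isClosed_polyhedron b)
    (Sweeping.convex_polyhedron b) hCV hcV hc hτ0 hfeasible
  refine ⟨fun y hy _ => hvert y hy, ys, hys, hys0,
    fun y hy h => hy.eqOn ha hys (h.trans hys0.symm), fun T hT hτT hper => ?_⟩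
  have hattr : ∀ y, Sweeping.IsSolution a V C c 0 y → Set.EqOn y ys (Set.Ici τd) := fun y hy =>
    (hy.mono hτ0).eqOn ha hys ((hvert y hy).trans hys0.symm)
  have hysper : Sweeping.PeriodicFrom ys τd T := by
    -- As τd ≤ T, `ys` shifted back by T solves the process from time 0, so it reaches the vertex at
    -- τd and agrees with `ys` afterwards.
    have hsol : Sweeping.IsSolution a V C c (0 + T) ys := hys.mono (by linarith)
    exact hattr _ (hsol.comp_add_right hper)
  have hmul : ∀ (f : ℝ → Sweeping.E m) (s : ℝ), Sweeping.PeriodicFrom f s T →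
      ∀ (k : ℕ) t, s ≤ t → f (t + k * T) = f t := by
    intro f s hf k
    induction k with
    | zero => simp
    | succ k ih =>
      intro t ht
      have hk : 0 ≤ (k : ℝ) * T := by positivity
      rw [← ih t ht, ← hf (t + k * T) (by linarith)]
      congr 1
      push_cast
      ring
  refine ⟨hysper, ⟨fun t₀ ht₀ η hη => ⟨η, hη, fun y hy hlt t ht =>
    (hy.normA_sub_le ha (hys.mono ht₀) ht).trans_lt hlt⟩, fun k y hy t ht => ?_⟩⟩
  have hsol : Sweeping.IsSolution a V C c (0 + k * T) y := by rwa [zero_add]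
  -- t ≥ (k+1)T leaves a full period T ≥ τd after the start at kT.
  have htτ : τd ≤ t - k * T := by linarith
  have h1 := hattr _ (hsol.comp_add_right (hmul c 0 hper k)) htτ
  have h2 := hmul ys τd hysper k _ htτ
  simp only [sub_add_cancel] at h1 h2
  rw [h1, h2]
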